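/- Let $M$ be a connected, complete Riemannian manifold, and let $I(M)$ be its full isometry group with the compact-open topology. Subgroups of $I(M)$ carry the subspace topology and act on $M$ by evaluation. Let $G$ be a group acting on $M$ by isometries (for example a Lie group acting isometrically, or any subgroup of $I(M)$, not necessarily closed). An action of a topological group $H$ on $M$ is called proper if the map $H\times M\to M\times M$, $(h,p)\mapsto (h(p),p)$, is proper. Two actions on $M$ are called orbit equivalent if there is an isometry of $M$ that maps the orbits of the first onto the orbits of the second. Then the orbits of the action of $G$ are closed if and only if the action is orbit equivalent to a proper isometric action. More precisely, the following are equivalent: 1. every orbit $G\cdot p$, $p\in M$, is closed in $M$; 2. the action of $G$ is orbit equivalent to the action of a subgroup $H\subset I(M)$ that acts properly on $M$; 3. there is a closed subgroup $H\subset I(M)$ that acts properly on $M$ and satisfies $G\cdot p=H\cdot p$ for all $p\in M$; 4. the action of $G$ is orbit equivalent to a proper isometric action on $M$ of some topological group $H$. (Since $I(M)$ is a Lie group by the Myers–Steenrod theorem, the closed subgroup $H$ in 3 is a Lie group.) -/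

import Mathlib

open scoped Manifold ContDiff Bundle

universe u v

/-- The full isometry group `I(M)` of a metric space `M` (for a Riemannian manifold: with respect to
its Riemannian distance); the group law is composition. -/
abbrev IsometryGroup (M : Type*) [PseudoEMetricSpace M] : Type _ := M ≃ᵢ M

/-- The compact-open topology on the isometry group. -/
instance IsometryGroup.instTopologicalSpace (M : Type*) [PseudoEMetricSpace M] :
    TopologicalSpace (IsometryGroup M) :=
  TopologicalSpace.induced (fun g : IsometryGroup M => (⟨g, g.continuous⟩ : C(M, M))) inferInstance

/-- The isometry group, and hence each of its subgroups, acts on `M` by evaluation. -/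
instance IsometryGroup.instMulAction (M : Type*) [PseudoEMetricSpace M] :
    MulAction (IsometryGroup M) M where
  smul g p := g p
  one_smul _ := rfl
  mul_smul _ _ _ := rfl

/-- The actions of two groups `G` and `H` on `M` are orbit equivalent if some isometry of `M`
carries the orbits of `G` onto the orbits of `H`. -/
def OrbitEquivalent (G H M : Type*) [PseudoEMetricSpace M] [Group G] [MulAction G M]
    [Group H] [MulAction H M] : Prop :=
  ∃ f : IsometryGroup M, ∀ p : M, f '' MulAction.orbit G p = MulAction.orbit H (f p)

open Filter Topology Set

/-! The core is that `I(M)` acts properly. Completeness makes closed balls compact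
(`HasBallSplitting.properSpace`); so if `x_i` and `g_i x_i` converge along an ultrafilter, the `g_i`
and their inverses converge pointwise, and the limit is an isometry (`instProperSMul`). Closed
subgroups inherit properness. If the orbits of `G` are closed, the closure of its image in `I(M)`
has the same orbits, because each condition `g p ∈ G p` is closed in `g`. Conversely, proper actions
have closed orbits, and isometries preserve closedness. -/

/-- In a length space, a point at distance less than `a + b` from `x` is within `b` of the closed
ball of radius `a` about `x`. -/
def HasBallSplitting (M : Type*) [PseudoMetricSpace M] : Prop :=
  ∀ (x y : M) (a b : ℝ), 0 ≤ a → 0 < b → dist x y < a + b → ∃ z, dist x z ≤ a ∧ dist z y < b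

/-- Cut a path of length less than `a + b` where its distance from `x` equals `a`: the first piece
has length at least `a`, so less than `b` remains. -/
theorem IsRiemannianManifold.hasBallSplitting {n : ℕ} {M : Type*} [MetricSpace M]
    [ChartedSpace (EuclideanSpace ℝ (Fin n)) M] [IsManifold (𝓡 n) ∞ M]
    [Bundle.RiemannianBundle (fun x : M => TangentSpace (𝓡 n) x)]
    [IsRiemannianManifold (𝓡 n) M] : HasBallSplitting M := by
  intro x y a b ha hb hxy
  rcases le_or_gt (dist x y) a with hle | hgt
  · exact ⟨y, hle, by simpa using hb⟩
  have hlt : Manifold.riemannianEDist (𝓡 n) x y < ENNReal.ofReal (a + b) := by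
    rw [← IsRiemannianManifold.out (I := 𝓡 n) x y, edist_dist]
    exact (ENNReal.ofReal_lt_ofReal_iff (by linarith)).2 hxy
  obtain ⟨γ, h0, h1, hγ, hlen⟩ := Manifold.exists_lt_of_riemannianEDist_lt hlt
  have hcont : ContinuousOn (fun t => dist x (γ t)) (Icc 0 1) :=
    (continuous_const.dist continuous_id).comp_continuousOn hγ.continuousOn
  obtain ⟨t, ht, hta⟩ := intermediate_value_Icc zero_le_one hcont
    (show a ∈ Icc (dist x (γ 0)) (dist x (γ 1)) by
      rw [h0, h1, dist_self]; exact ⟨ha, hgt.le⟩)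
  refine ⟨γ t, hta.le, ?_⟩
  have hfst : ENNReal.ofReal a ≤ Manifold.pathELength (𝓡 n) γ 0 t := by
    rw [← hta, ← edist_dist, IsRiemannianManifold.out (I := 𝓡 n) x (γ t)]
    exact Manifold.riemannianEDist_le_pathELength
      (hγ.mono (Icc_subset_Icc_right ht.2)) h0 rfl ht.1
  have hsnd : edist (γ t) y ≤ Manifold.pathELength (𝓡 n) γ t 1 := by
    rw [IsRiemannianManifold.out (I := 𝓡 n) (γ t) y]
    exact Manifold.riemannianEDist_le_pathELength
      (hγ.mono (Icc_subset_Icc_left ht.1)) rfl h1 ht.2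
  rw [← Manifold.pathELength_add ht.1 ht.2, ENNReal.ofReal_add ha hb.le] at hlen
  have hsum := (add_le_add hfst hsnd).trans_lt hlen
  rw [edist_dist] at hsum
  exact (ENNReal.ofReal_lt_ofReal_iff hb).1
    ((ENNReal.add_lt_add_iff_left ENNReal.ofReal_ne_top).1 hsum)

/-- The Hopf–Rinow–Cohn-Vossen theorem: closed balls in a complete, locally compact length space
are compact. -/
theorem HasBallSplitting.properSpace {M : Type*} [MetricSpace M] [CompleteSpace M]
    [LocallyCompactSpace M] (hM : HasBallSplitting M) : ProperSpace M := by
  refine ⟨fun p => ?_⟩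
  by_contra! ⟨r₀, hr₀⟩
  set S : Set ℝ := {r | IsCompact (Metric.closedBall p r)} with hS
  have hbdd : BddAbove S := by
    refine ⟨r₀, fun r hr => le_of_not_gt fun hlt => hr₀ ?_⟩
    exact IsCompact.of_isClosed_subset hr Metric.isClosed_closedBall
      (Metric.closedBall_subset_closedBall hlt.le)
  have hzero : (0 : ℝ) ∈ S := by simp [hS]
  set R := sSup S with hR
  have hRnonneg : 0 ≤ R := le_csSup hbdd hzero
  have hcompact : IsCompact (Metric.closedBall p R) := by
    refine TotallyBounded.isCompact_of_isClosed ?_ Metric.isClosed_closedBall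
    refine Metric.totallyBounded_iff.2 fun ε hε => ?_
    obtain ⟨s, hs, hsR⟩ := exists_lt_of_lt_csSup ⟨0, hzero⟩ (show R - ε / 2 < sSup S by linarith)
    -- The radius `s` may be negative, whereas ball splitting needs a nonnegative one.
    obtain ⟨t, ht, hcover⟩ := Metric.totallyBounded_iff.1
      (show IsCompact (Metric.closedBall p (max s 0)) by
        rcases max_choice s 0 with h | h <;> rw [h] <;> assumption).totallyBounded
      (ε / 2) (by linarith)
    refine ⟨t, ht, fun x hx => ?_⟩
    obtain ⟨z, hz, hzx⟩ := hM p x (max s 0) (ε / 2) (le_max_right _ _) (by linarith) (by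
      rw [Metric.mem_closedBall, dist_comm] at hx
      linarith [le_max_left s 0])
    obtain ⟨y, hy, hzy⟩ := mem_iUnion₂.1 (hcover (Metric.mem_closedBall'.2 hz))
    refine mem_iUnion₂.2 ⟨y, hy, ?_⟩
    rw [Metric.mem_ball] at hzy ⊢
    linarith [dist_triangle x z y, dist_comm z x]
  -- Local compactness pushes the compact radius past the supremum `R`.
  obtain ⟨δ, hδ, hthick⟩ := hcompact.exists_isCompact_cthickening
  have hmem : R + δ / 2 ∈ S := by
    refine IsCompact.of_isClosed_subset hthick Metric.isClosed_closedBall fun x hx => ?_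
    rw [Metric.mem_closedBall, dist_comm] at hx
    obtain ⟨z, hz, hzx⟩ := hM p x R δ hRnonneg hδ (by linarith)
    exact Metric.mem_cthickening_of_dist_le x z δ _ (Metric.mem_closedBall'.2 hz)
      (by rw [dist_comm]; exact hzx.le)
  linarith [le_csSup hbdd hmem]

theorem Ultrafilter.exists_tendsto_of_eventually_dist_le {M : Type*} [PseudoMetricSpace M]
    [ProperSpace M] {ι : Type*} {l : Ultrafilter ι}
    {u : ι → M} {p : M} {r : ℝ} (h : ∀ᶠ i in (l : Filter ι), dist (u i) p ≤ r) :
    ∃ q, Tendsto u l (𝓝 q) := by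
  obtain ⟨q, -, hq⟩ := (isCompact_closedBall p r).ultrafilter_le_nhds (l.map u)
    (le_principal_iff.2 h)
  exact ⟨q, hq⟩

namespace IsometryGroup

variable {M : Type*}

/-- A group acting by isometries maps to the isometry group. -/
def ofIsometricSMul (G M : Type*) [PseudoEMetricSpace M] [Group G] [MulAction G M]
    [IsIsometricSMul G M] : G →* IsometryGroup M where
  toFun g := IsometryEquiv.constSMul g
  map_one' := by ext x; exact one_smul G x
  map_mul' g h := by ext x; exact mul_smul g h x

variable [MetricSpace M] [LocallyCompactSpace M]

/-- Convergence of isometries in the compact-open topology is pointwise convergence. -/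
theorem tendsto_nhds_iff {ι : Type*} {l : Filter ι} {φ : ι → IsometryGroup M}
    {f : IsometryGroup M} :
    Tendsto φ l (𝓝 f) ↔ ∀ x, Tendsto (fun i => φ i x) l (𝓝 (f x)) := by
  rw [nhds_induced, tendsto_comap_iff]
  constructor
  · intro h x
    exact ((continuous_eval_const (F := C(M, M)) x).tendsto _).comp h
  · intro h
    rw [ContinuousMap.tendsto_iff_tendstoLocallyUniformly, Metric.tendstoLocallyUniformly_iff]
    intro ε hε x
    -- Isometries are equicontinuous, so closeness at `x` gives uniform closeness on a ball.
    refine ⟨Metric.ball x (ε / 3), Metric.ball_mem_nhds x (by positivity), ?_⟩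
    filter_upwards [Metric.tendsto_nhds.1 (h x) (ε / 3) (by positivity)] with i hi y hy
    rw [Metric.mem_ball] at hy
    change dist (f y) (φ i y) < ε
    have h₁ := f.isometry.dist_eq y x
    have h₂ := (φ i).isometry.dist_eq y x
    linarith [dist_triangle4 (f y) (f x) (φ i x) (φ i y), dist_comm (f x) (φ i x),
      dist_comm (φ i y) (φ i x)]

theorem tendsto_apply (f : IsometryGroup M) (x : M) :
    Tendsto (fun g : IsometryGroup M => g x) (𝓝 f) (𝓝 (f x)) :=
  tendsto_nhds_iff.1 tendsto_id x

theorem tendsto_apply_prod (f : IsometryGroup M) (x : M) :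
    Tendsto (fun q : IsometryGroup M × M => q.1 q.2) (𝓝 (f, x)) (𝓝 (f x)) := by
  rw [tendsto_iff_dist_tendsto_zero]
  have h₁ : Tendsto (fun q : IsometryGroup M × M => dist q.2 x + dist (q.1 x) (f x))
      (𝓝 (f, x)) (𝓝 0) := by
    have hsnd := tendsto_iff_dist_tendsto_zero.1 ((continuous_snd (X := IsometryGroup M)).tendsto
      (f, x))
    have hfst := tendsto_iff_dist_tendsto_zero.1
      ((tendsto_apply f x).comp ((continuous_fst (Y := M)).tendsto (f, x)))
    simpa using hsnd.add hfst
  refine squeeze_zero (fun _ => dist_nonneg) (fun q => ?_) h₁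
  rw [← q.1.isometry.dist_eq q.2 x]
  exact dist_triangle _ _ _

instance instContinuousSMul : ContinuousSMul (IsometryGroup M) M :=
  ⟨continuous_iff_continuousAt.2 fun q => tendsto_apply_prod q.1 q.2⟩

instance instIsTopologicalGroup : IsTopologicalGroup (IsometryGroup M) where
  continuous_mul := continuous_iff_continuousAt.2 fun ⟨f, g⟩ => tendsto_nhds_iff.2 fun x =>
    (tendsto_apply_prod f (g x)).comp
      ((continuous_fst.tendsto (f, g)).prodMk_nhds
        ((tendsto_apply g x).comp (continuous_snd.tendsto (f, g))))
  continuous_inv := continuous_iff_continuousAt.2 fun f => tendsto_nhds_iff.2 fun x => by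
    rw [tendsto_iff_dist_tendsto_zero]
    have h := tendsto_iff_dist_tendsto_zero.1 (tendsto_apply f (f⁻¹ x))
    refine h.congr fun g => ?_
    rw [f.apply_inv_self, dist_comm, ← g.isometry.dist_eq (g⁻¹ x), g.apply_inv_self]

/-- The isometry group of a proper metric space acts properly. -/
instance instProperSMul [ProperSpace M] : ProperSMul (IsometryGroup M) M := by
  refine properSMul_iff_continuousSMul_ultrafilter_tendsto_t2.2 ⟨inferInstance, ?_⟩
  intro 𝒰 q p h
  have hq : Tendsto (fun gx : IsometryGroup M × M => gx.1 gx.2) 𝒰 (𝓝 q) :=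
    (continuous_fst.tendsto _).comp h
  have hp : Tendsto (fun gx : IsometryGroup M × M => gx.2) 𝒰 (𝓝 p) :=
    (continuous_snd.tendsto _).comp h
  have hq₁ := Metric.tendsto_nhds.1 hq 1 one_pos
  have hp₁ := Metric.tendsto_nhds.1 hp 1 one_pos
  have hlim (x : M) : ∃ y, Tendsto (fun gx : IsometryGroup M × M => gx.1 x) 𝒰 (𝓝 y) := by
    refine Ultrafilter.exists_tendsto_of_eventually_dist_le (p := q) (r := dist x p + 1 + 1) ?_
    filter_upwards [hq₁, hp₁] with gx h₁ h₂
    have h₃ := gx.1.isometry.dist_eq x gx.2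
    linarith [dist_triangle (gx.1 x) (gx.1 gx.2) q, dist_triangle x p gx.2, dist_comm p gx.2]
  have hlim' (x : M) : ∃ y, Tendsto (fun gx : IsometryGroup M × M => gx.1⁻¹ x) 𝒰 (𝓝 y) := by
    refine Ultrafilter.exists_tendsto_of_eventually_dist_le (p := p) (r := dist x q + 1 + 1) ?_
    filter_upwards [hq₁, hp₁] with gx h₁ h₂
    have h₃ := gx.1.isometry.dist_eq (gx.1⁻¹ x) gx.2
    rw [IsometryEquiv.apply_inv_self] at h₃
    linarith [dist_triangle (gx.1⁻¹ x) gx.2 p, dist_triangle x q (gx.1 gx.2),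
      dist_comm q (gx.1 gx.2)]
  choose F hF using hlim
  choose F' hF' using hlim'
  have hisom : Isometry F := Isometry.of_dist_eq fun x y =>
    tendsto_nhds_unique ((hF x).dist (hF y))
      (by simp only [fun g : IsometryGroup M => g.isometry.dist_eq x y, tendsto_const_nhds])
  -- The limit of the inverses makes `F` surjective.
  have hright (x : M) : F (F' x) = x := by
    have h₁ : Tendsto (fun gx : IsometryGroup M × M => dist (gx.1 (F' x)) x) 𝒰 (𝓝 0) := by
      have h₂ := tendsto_iff_dist_tendsto_zero.1 (hF' x)
      refine h₂.congr fun gx => ?_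
      rw [dist_comm, ← gx.1.isometry.dist_eq, IsometryEquiv.apply_inv_self]
    exact tendsto_nhds_unique (hF (F' x)) (tendsto_iff_dist_tendsto_zero.2 h₁)
  exact ⟨IsometryEquiv.mk' F F' hright hisom, tendsto_nhds_iff.2 hF⟩

/-- If all orbits of an isometric action are closed, then the closure of its image in the isometry
group has the same orbits. -/
theorem orbit_topologicalClosure_range (G : Type*) [Group G] [MulAction G M]
    [IsIsometricSMul G M] {p : M} (hp : IsClosed (MulAction.orbit G p)) :
    MulAction.orbit (ofIsometricSMul G M).range.topologicalClosure p = MulAction.orbit G p := by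
  apply Subset.antisymm
  · rintro _ ⟨⟨h, hh⟩, rfl⟩
    have hclosed : IsClosed {g : IsometryGroup M | g • p ∈ MulAction.orbit G p} :=
      hp.preimage (continuous_id.smul continuous_const)
    refine closure_minimal ?_ hclosed hh
    rintro _ ⟨g, rfl⟩
    exact ⟨g, rfl⟩
  · rintro _ ⟨g, rfl⟩
    exact ⟨⟨ofIsometricSMul G M g, Subgroup.le_topologicalClosure _ ⟨g, rfl⟩⟩, rfl⟩

end IsometryGroup

/-- The orbit is the translate of the compact set `{p}` by the closed set `G`, which is closed for a
proper action. -/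
theorem MulAction.isClosed_orbit_of_properSMul {G X : Type*} [Group G] [TopologicalSpace G]
    [TopologicalSpace X] [T1Space X] [MulAction G X] [ProperSMul G X] (p : X) :
    IsClosed (MulAction.orbit G p) := by
  have h := IsClosed.smul_right_of_isCompact (isClosed_univ (X := G)) (isCompact_singleton (x := p))
  convert h using 1
  ext x
  simp [MulAction.mem_orbit_iff]

theorem OrbitEquivalent.isClosed_orbit {G H M : Type*} [PseudoEMetricSpace M] [Group G]
    [MulAction G M] [Group H] [MulAction H M] (h : OrbitEquivalent G H M)
    (hH : ∀ p : M, IsClosed (MulAction.orbit H p)) (p : M) : IsClosed (MulAction.orbit G p) := by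
  obtain ⟨f, hf⟩ := h
  have hp : IsClosed (f '' MulAction.orbit G p) := hf p ▸ hH (f p)
  exact f.toHomeomorph.isClosed_image.1 hp

theorem OrbitEquivalent.of_orbit_eq {G H M : Type*} [PseudoEMetricSpace M] [Group G]
    [MulAction G M] [Group H] [MulAction H M]
    (h : ∀ p : M, MulAction.orbit G p = MulAction.orbit H p) : OrbitEquivalent G H M :=
  ⟨IsometryEquiv.refl M, fun p => by
    rw [h p]
    exact image_id _⟩

theorem mainTheorem3 {n : ℕ} {M : Type u} [MetricSpace M]
    [ChartedSpace (EuclideanSpace ℝ (Fin n)) M] [IsManifold (𝓡 n) ∞ M]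
    [Bundle.RiemannianBundle (fun x : M => TangentSpace (𝓡 n) x)]
    [IsContMDiffRiemannianBundle (𝓡 n) ∞ (EuclideanSpace ℝ (Fin n))
      (fun x : M => TangentSpace (𝓡 n) x)]
    [IsRiemannianManifold (𝓡 n) M] [ConnectedSpace M] [CompleteSpace M]
    (G : Type v) [Group G] [MulAction G M] [IsIsometricSMul G M] :
    List.TFAE [
      -- the orbits of the isometric action of `G` are closed
      ∀ p : M, IsClosed (MulAction.orbit G p),
      -- it is orbit equivalent to the action of a subgroup of `I(M)` acting properly
      ∃ H : Subgroup (IsometryGroup M), ProperSMul H M ∧ OrbitEquivalent G H M,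
      -- it has the same orbits as a closed subgroup of `I(M)` acting properly
      ∃ H : Subgroup (IsometryGroup M), IsClosed (H : Set (IsometryGroup M)) ∧ ProperSMul H M ∧
        ∀ p : M, MulAction.orbit G p = MulAction.orbit H p,
      -- it is orbit equivalent to a proper isometric action of some topological group
      ∃ (H : Type u) (_ : Group H) (_ : TopologicalSpace H) (_ : IsTopologicalGroup H)
        (_ : MulAction H M),
        IsIsometricSMul H M ∧ ProperSMul H M ∧ OrbitEquivalent G H M] := by
  have : LocallyCompactSpace M := ChartedSpace.locallyCompactSpace (EuclideanSpace ℝ (Fin n)) M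
  have : ProperSpace M :=
    (IsRiemannianManifold.hasBallSplitting (n := n) (M := M)).properSpace
  tfae_have 1 → 3 := fun h => by
    have hclosed : IsClosed
        ((IsometryGroup.ofIsometricSMul G M).range.topologicalClosure : Set (IsometryGroup M)) :=
      Subgroup.isClosed_topologicalClosure _
    -- Properness restricts from `I(M)` to the subgroup because of `hclosed`.
    exact ⟨_, hclosed, inferInstance,
      fun p => (IsometryGroup.orbit_topologicalClosure_range G (h p)).symm⟩
  tfae_have 3 → 2 := fun ⟨H, _, hproper, horbit⟩ => ⟨H, hproper, .of_orbit_eq horbit⟩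
  tfae_have 2 → 4 := fun ⟨H, hproper, hequiv⟩ =>
    ⟨H, inferInstance, inferInstance, inferInstance, inferInstance,
      ⟨fun h => h.1.isometry⟩, hproper, hequiv⟩
  tfae_have 4 → 1 := fun ⟨_, _, _, _, _, _, _, hequiv⟩ =>
    hequiv.isClosed_orbit fun p => MulAction.isClosed_orbit_of_properSMul p
  tfae_finish
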